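/- Let $A$ be a $C^*$-algebra and let $X$ be an $A$--$A$-correspondence, that is, a right Hilbert $A$-module with a $*$-homomorphism $\varphi : A \to \mathcal{L}(X)$ into the adjointable operators (no grading, separability, nuclearity, countable generation or nondegeneracy is needed). For a right Hilbert module $Z$ let $\mathcal{K}(Z) = \overline{\operatorname{span}}\{\Theta_{\xi,\eta} : \xi,\eta\in Z\}\subseteq\mathcal{L}(Z)$, where $\Theta_{\xi,\eta}(\zeta) = \xi\cdot\langle\eta,\zeta\rangle$. Put $\ker\varphi^\perp = \{b\in A : b\ker\varphi = \{0\}\}$ and $J_X = \varphi^{-1}(\mathcal{K}(X))\cap\ker\varphi^\perp$. Let $K_\varphi^\infty = \bigoplus_{n=1}^\infty \ker\varphi$ be the $c_0$-direct sum of countably many copies of $\ker\varphi$, let $T = K_\varphi^\infty$ be regarded as a right Hilbert module over itself, and let $Y = X\oplus T$ be the right Hilbert $A\oplus K_\varphi^\infty$-module with $(x,g)\cdot(a,f) = (x\cdot a, gf)$ and $\langle (x,g),(x',g')\rangle = (\langle x,x'\rangle, g^*g')$. Let $\varphi^Y : A\oplus K_\varphi^\infty\to\mathcal{L}(Y)$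 be the $*$-homomorphism \[ \varphi^Y(a,f)(x,g) = (\varphi(a)x,\ a g_1,\ f_1 g_2,\ f_2 g_3, \dots). \] Then \[ (\varphi^Y)^{-1}(\mathcal{K}(Y)) = J_X\oplus\ker\varphi\oplus K_\varphi^\infty , \] where the right-hand side is regarded as a subset of $A\oplus K_\varphi^\infty$ via $(j,k,f)\mapsto (j+k,f)$; that is, this map is an injective $*$-homomorphism from the external direct sum $J_X\oplus\ker\varphi\oplus K_\varphi^\infty$ to $A\oplus K_\varphi^\infty$, and its range is $(\varphi^Y)^{-1}(\mathcal{K}(Y))$. -/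

import Mathlib

open scoped ZeroAtInfty

set_option linter.unusedSectionVars false

noncomputable section

namespace AddingTails

/-! ### Adjointable and compact operators on a Hilbert module

Mathlib's `CStarModule C E` is a Hilbert module with a *left* action of `C` and with
`⟪x, c • y⟫ = c * ⟪x, y⟫`. A right Hilbert module `X` over a C⋆-algebra `B` is therefore the same
thing as a `CStarModule Bᵐᵒᵖ X`: the right action is `x · b = op b • x`, the inner product is
`⟨x, y⟩ = unop ⟪x, y⟫`, and `⟨x, y · b⟩ = ⟨x, y⟩ b`. This section is written over `C`;
later `C` is `Bᵐᵒᵖ`. -/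

section Adjointable

variable {C : Type*} {X : Type*} [NonUnitalCStarAlgebra C] [PartialOrder C] [StarOrderedRing C]
  [NormedAddCommGroup X] [NormedSpace ℂ X] [SMul C X] [CStarModule C X]

theorem ext_inner {x y : X} (h : ∀ z : X, inner C z x = inner C z y) : x = y := by
  rw [← sub_eq_zero, ← CStarModule.inner_self (A := C), CStarModule.inner_sub_right, h, sub_self]

theorem ext_inner_left {x y : X} (h : ∀ z : X, inner C x z = inner C y z) : x = y := by
  refine ext_inner (C := C) fun z => ?_
  rw [← CStarModule.star_inner, h, CStarModule.star_inner]

theorem norm_smul_le' (c : C) (x : X) : ‖c • x‖ ≤ ‖c‖ * ‖x‖ := by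
  have h : ‖c • x‖ ^ 2 ≤ (‖c‖ * ‖x‖) ^ 2 := by
    rw [CStarModule.norm_sq_eq (A := C), mul_pow, CStarModule.norm_sq_eq (A := C) (x := x),
      CStarModule.inner_op_smul_right, CStarModule.inner_op_smul_left]
    calc ‖c * (inner C x x * star c)‖ ≤ ‖c‖ * (‖inner C x x‖ * ‖star c‖) :=
          (norm_mul_le _ _).trans (by gcongr; exact norm_mul_le _ _)
      _ = ‖c‖ ^ 2 * ‖inner C x x‖ := by rw [norm_star]; ring
  exact (pow_le_pow_iff_left₀ (norm_nonneg _) (by positivity) two_ne_zero).mp h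

variable (C X) in
/-- `𝓛(X)`: the operators on `X` that have an adjoint. -/
def adjointable : Subalgebra ℂ (X →L[ℂ] X) where
  carrier := {T | ∃ S : X →L[ℂ] X, ∀ x y, inner C (T x) y = inner C x (S y)}
  mul_mem' := by
    rintro T₁ T₂ ⟨S₁, h₁⟩ ⟨S₂, h₂⟩
    exact ⟨S₂ * S₁, fun x y => by simp [h₁, h₂]⟩
  add_mem' := by
    rintro T₁ T₂ ⟨S₁, h₁⟩ ⟨S₂, h₂⟩
    exact ⟨S₁ + S₂, fun x y => by simp [h₁, h₂]⟩
  algebraMap_mem' r := ⟨algebraMap ℂ _ (star r), fun x y => by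
    simp [Algebra.algebraMap_eq_smul_one]⟩

theorem adj_unique {T S S' : X →L[ℂ] X} (h : ∀ x y, inner C (T x) y = inner C x (S y))
    (h' : ∀ x y, inner C (T x) y = inner C x (S' y)) : S = S' := by
  ext y
  exact ext_inner (C := C) fun z => by rw [← h, h']

theorem adj_symm {T S : X →L[ℂ] X} (h : ∀ x y, inner C (T x) y = inner C x (S y)) (x y : X) :
    inner C (S x) y = inner C x (T y) := by
  rw [← CStarModule.star_inner, ← h, CStarModule.star_inner]

/-- The adjoint on `𝓛(X)`. -/
instance : Star (adjointable C X) where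
  star T := ⟨T.2.choose, T.1, adj_symm T.2.choose_spec⟩

theorem inner_star (T : adjointable C X) (x y : X) :
    inner C (T.1 x) y = inner C x ((star T).1 y) := T.2.choose_spec x y

theorem star_eq_of {T S : adjointable C X} (h : ∀ x y, inner C (T.1 x) y = inner C x (S.1 y)) :
    star T = S := Subtype.ext (adj_unique (inner_star T) h)

instance : StarRing (adjointable C X) where
  star_involutive T := star_eq_of (adj_symm (inner_star T))
  star_mul T S := star_eq_of fun x y => by
    change inner C (T.1 (S.1 x)) y = inner C x ((star S).1 ((star T).1 y))
    rw [inner_star, inner_star]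
  star_add T S := star_eq_of fun x y => by
    change inner C (T.1 x + S.1 x) y = inner C x ((star T).1 y + (star S).1 y)
    rw [CStarModule.inner_add_left, CStarModule.inner_add_right, inner_star, inner_star]

instance : StarModule ℂ (adjointable C X) where
  star_smul c T := star_eq_of fun x y => by
    change inner C (c • T.1 x) y = inner C x (star c • (star T).1 y)
    rw [CStarModule.inner_smul_left_complex, CStarModule.inner_smul_right_complex, inner_star]

theorem norm_star_apply_le (T : adjointable C X) (y : X) : ‖(star T).1 y‖ ≤ ‖T.1‖ * ‖y‖ := by
  set z := (star T).1 y
  have h : ‖z‖ * ‖z‖ ≤ ‖T.1‖ * ‖y‖ * ‖z‖ := by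
    rw [← sq, CStarModule.norm_sq_eq (A := C), ← inner_star]
    calc _ ≤ ‖T.1 z‖ * ‖y‖ := CStarModule.norm_inner_le X
      _ ≤ ‖T.1‖ * ‖z‖ * ‖y‖ := by gcongr; exact T.1.le_opNorm z
      _ = _ := by ring
  rcases (norm_nonneg z).eq_or_lt with h0 | h0
  · rw [← h0]; positivity
  · exact le_of_mul_le_mul_right h h0

theorem norm_star_le (T : adjointable C X) : ‖star T‖ ≤ ‖T‖ :=
  ContinuousLinearMap.opNorm_le_bound _ (norm_nonneg _) (norm_star_apply_le T)

instance : ContinuousStar (adjointable C X) where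
  continuous_star := by
    refine (LipschitzWith.of_dist_le_mul (K := 1) fun T S => ?_).continuous
    have h := norm_star_le (T - S)
    rw [star_sub] at h
    rw [NNReal.coe_one, one_mul, dist_eq_norm, dist_eq_norm]
    exact h

theorem norm_le_sqrt (T : adjointable C X) : ‖T.1‖ ≤ √‖(star T * T).1‖ := by
  refine ContinuousLinearMap.opNorm_le_bound _ (Real.sqrt_nonneg _) fun x => ?_
  refine (pow_le_pow_iff_left₀ (norm_nonneg _) (by positivity) two_ne_zero).mp ?_
  rw [mul_pow, Real.sq_sqrt (norm_nonneg _), CStarModule.norm_sq_eq (A := C), inner_star]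
  calc _ ≤ ‖x‖ * ‖(star T).1 (T.1 x)‖ := CStarModule.norm_inner_le X
    _ ≤ ‖x‖ * (‖(star T * T).1‖ * ‖x‖) := by
      gcongr
      exact (star T * T).1.le_opNorm x
    _ = _ := by ring

instance : CStarRing (adjointable C X) where
  norm_mul_self_le T := by
    change ‖T.1‖ * ‖T.1‖ ≤ ‖(star T * T).1‖
    calc ‖T.1‖ * ‖T.1‖ ≤ √‖(star T * T).1‖ * √‖(star T * T).1‖ := by
          gcongr <;> exact norm_le_sqrt T
      _ = _ := Real.mul_self_sqrt (norm_nonneg _)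

theorem isClosed_adjointable [CompleteSpace X] :
    IsClosed (adjointable C X : Set (X →L[ℂ] X)) := by
  refine IsSeqClosed.isClosed fun T T' hT hlim => ?_
  let U : ℕ → adjointable C X := fun n => ⟨T n, hT n⟩
  have hU : CauchySeq U := by
    have := hlim.cauchySeq
    rw [Metric.cauchySeq_iff] at this ⊢
    exact this
  have hS : CauchySeq fun n => (star (U n)).1 := by
    rw [Metric.cauchySeq_iff] at hU ⊢
    intro ε hε
    obtain ⟨N, hN⟩ := hU ε hε
    refine ⟨N, fun m hm n hn => lt_of_le_of_lt ?_ (hN m hm n hn)⟩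
    change dist (star (U m)) (star (U n)) ≤ _
    rw [dist_eq_norm, dist_eq_norm]
    have h := norm_star_le (U m - U n)
    rwa [star_sub] at h
  obtain ⟨S, hS⟩ := cauchySeq_tendsto_of_complete hS
  refine ⟨S, fun x y => ?_⟩
  have h1 : Filter.Tendsto (fun n => inner C (T n x) y) Filter.atTop (nhds (inner C (T' x) y)) :=
    (CStarModule.continuous_inner (A := C) (E := X)).tendsto (T' x, y) |>.comp
      (((ContinuousLinearMap.apply ℂ X x).continuous.tendsto T').comp hlim |>.prodMk_nhds
        tendsto_const_nhds)
  have h2 : Filter.Tendsto (fun n => inner C x ((star (U n)).1 y)) Filter.atTop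
      (nhds (inner C x (S y))) :=
    (CStarModule.continuous_inner (A := C) (E := X)).tendsto (x, S y) |>.comp
      (tendsto_const_nhds.prodMk_nhds
        (((ContinuousLinearMap.apply ℂ X y).continuous.tendsto S).comp hS))
  refine tendsto_nhds_unique h1 (h2.congr fun n => ?_)
  exact (inner_star (U n) x y).symm

instance [CompleteSpace X] : CStarAlgebra (adjointable C X) where
  toCompleteSpace := (isClosed_adjointable (C := C) (X := X)).completeSpace_coe

variable (C) in
/-- The operator `Θ_{ξ, η} : ζ ↦ ξ · ⟨η, ζ⟩`. -/
def theta (ξ η : X) : X →L[ℂ] X :=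
  LinearMap.mkContinuous
    { toFun := fun ζ => (inner C η ζ : C) • ξ
      map_add' := fun x y => ext_inner (C := C) fun z => by simp [add_mul]
      map_smul' := fun c x => ext_inner (C := C) fun z => by simp [smul_mul_assoc] }
    (‖ξ‖ * ‖η‖) fun ζ => by
      calc ‖(inner C η ζ : C) • ξ‖ ≤ ‖(inner C η ζ : C)‖ * ‖ξ‖ := norm_smul_le' _ _
        _ ≤ ‖η‖ * ‖ζ‖ * ‖ξ‖ := by gcongr; exact CStarModule.norm_inner_le X
        _ = _ := by ring

theorem theta_apply (ξ η ζ : X) : theta C ξ η ζ = (inner C η ζ : C) • ξ := rfl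

theorem theta_adj (ξ η x y : X) : inner C (theta C ξ η x) y = inner C x (theta C η ξ y) := by
  simp [theta_apply]

variable (C) in
/-- `Θ_{ξ, η}` as an element of `𝓛(X)`. -/
def Theta (ξ η : X) : adjointable C X := ⟨theta C ξ η, theta C η ξ, theta_adj ξ η⟩

theorem star_Theta (ξ η : X) : star (Theta C ξ η) = Theta C η ξ := star_eq_of (theta_adj ξ η)

theorem mul_Theta (T : adjointable C X) (ξ η : X) : T * Theta C ξ η = Theta C (T.1 ξ) η := by
  refine Subtype.ext (ContinuousLinearMap.ext fun ζ => ext_inner_left (C := C) fun z => ?_)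
  change inner C (T.1 ((inner C η ζ : C) • ξ)) z = inner C ((inner C η ζ : C) • T.1 ξ) z
  simp [inner_star]

variable (C X) in
/-- The closed linear span of the operators `Θ_{ξ, η}` in the operator norm. -/
def compactSpan : Submodule ℂ (adjointable C X) :=
  (Submodule.span ℂ {T | ∃ ξ η : X, T = Theta C ξ η}).topologicalClosure

theorem star_mem_compactSpan {T : adjointable C X} (hT : T ∈ compactSpan C X) :
    star T ∈ compactSpan C X := by
  refine map_mem_closure continuous_star hT fun S hS => ?_
  induction hS using Submodule.span_induction with
  | mem S h =>
    obtain ⟨ξ, η, rfl⟩ := h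
    exact Submodule.subset_span ⟨η, ξ, star_Theta ξ η⟩
  | zero => simp
  | add S S' _ _ h h' => rw [star_add]; exact add_mem h h'
  | smul c S _ h => rw [star_smul]; exact Submodule.smul_mem _ _ h

theorem mul_mem_compactSpan (T : adjointable C X) {S : adjointable C X}
    (hS : S ∈ compactSpan C X) : T * S ∈ compactSpan C X := by
  refine map_mem_closure (continuous_const_mul T) hS fun S hS => ?_
  induction hS using Submodule.span_induction with
  | mem S h =>
    obtain ⟨ξ, η, rfl⟩ := h
    exact Submodule.subset_span ⟨T.1 ξ, η, mul_Theta T ξ η⟩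
  | zero => simp
  | add S S' _ _ h h' => rw [mul_add]; exact add_mem h h'
  | smul c S _ h => rw [mul_smul_comm]; exact Submodule.smul_mem _ _ h

variable (C X) in
/-- `𝓚(X)`, the generalised compact operators: the closed linear span of the `Θ_{ξ, η}`, as a
⋆-subalgebra of `𝓛(X)`. -/
def compacts : NonUnitalStarSubalgebra ℂ (adjointable C X) where
  __ := compactSpan C X
  mul_mem' := fun {T _} _ hS => mul_mem_compactSpan T hS
  star_mem' := star_mem_compactSpan

end Adjointable

/-! ### Right Hilbert modules over C⋆-algebras

Right Hilbert `B`-modules are formed with respect to the usual C⋆-order on `Bᵐᵒᵖ` (which is the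
usual C⋆-order of `B`): the positive elements are the `s* s`, see `nonneg_op_iff`. -/

instance opOrder (B : Type*) [NonUnitalCStarAlgebra B] : PartialOrder Bᵐᵒᵖ :=
  CStarAlgebra.spectralOrder Bᵐᵒᵖ

instance opStarOrderedRing (B : Type*) [NonUnitalCStarAlgebra B] : StarOrderedRing Bᵐᵒᵖ :=
  CStarAlgebra.spectralOrderedRing Bᵐᵒᵖ

open MulOpposite

theorem nonneg_op_iff {B : Type*} [NonUnitalCStarAlgebra B] (b : Bᵐᵒᵖ) :
    0 ≤ b ↔ ∃ s : B, b = op (star s * s) := by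
  rw [CStarAlgebra.nonneg_iff_eq_mul_star_self]
  constructor
  · rintro ⟨s, rfl⟩
    exact ⟨unop s, rfl⟩
  · rintro ⟨s, rfl⟩
    exact ⟨op s, rfl⟩

/-- A C⋆-algebra `K` as a right Hilbert module `K_K`, with `⟨f, g⟩ = f* g` and the right action by
multiplication. -/
instance selfModule (K : Type*) [NonUnitalCStarAlgebra K] : CStarModule Kᵐᵒᵖ K where
  inner f g := op (star f * g)
  inner_add_right := by simp [mul_add]
  inner_self_nonneg {f} := (nonneg_op_iff _).2 ⟨f, rfl⟩
  inner_self {f} := by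
    rw [op_eq_zero_iff, CStarRing.star_mul_self_eq_zero_iff]
  inner_op_smul_right {a f g} := by
    apply unop_injective
    simp [mul_assoc]
  inner_smul_right_complex {z f g} := by
    apply unop_injective
    exact mul_smul_comm z (star f) g
  star_inner f g := by
    apply unop_injective
    simp
  norm_eq_sqrt_norm_inner_self f := by
    rw [norm_op, CStarRing.norm_star_mul_self, Real.sqrt_mul_self (norm_nonneg _)]

section Sum

variable {B D : Type*} [NonUnitalCStarAlgebra B] [NonUnitalCStarAlgebra D]
  {X Z : Type*} [NormedAddCommGroup X] [NormedSpace ℂ X] [SMul Bᵐᵒᵖ X] [CStarModule Bᵐᵒᵖ X]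
  [NormedAddCommGroup Z] [NormedSpace ℂ Z] [SMul Dᵐᵒᵖ Z] [CStarModule Dᵐᵒᵖ Z]

/-- The right action of `B ⊕ D` on the external direct sum `X ⊕ Z` of a right Hilbert `B`-module
and a right Hilbert `D`-module: `(x, z) · (b, d) = (x · b, z · d)`. -/
instance sumSMul : SMul (B × D)ᵐᵒᵖ (X × Z) where
  smul c y := (op (unop c).1 • y.1, op (unop c).2 • y.2)

/-- The external direct sum `X ⊕ Z` as a right Hilbert `B ⊕ D`-module:
`⟨(x, z), (x', z')⟩ = (⟨x, x'⟩, ⟨z, z'⟩)`. The resulting norm is the maximum of the norms. -/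
instance sumModule : CStarModule (B × D)ᵐᵒᵖ (X × Z) where
  inner y y' := op (unop (inner Bᵐᵒᵖ y.1 y'.1), unop (inner Dᵐᵒᵖ y.2 y'.2))
  inner_add_right := by
    intros
    apply unop_injective
    simp
  inner_self_nonneg {y} := by
    obtain ⟨s, hs⟩ := (nonneg_op_iff _).1 (CStarModule.inner_self_nonneg (A := Bᵐᵒᵖ) (x := y.1))
    obtain ⟨t, ht⟩ := (nonneg_op_iff _).1 (CStarModule.inner_self_nonneg (A := Dᵐᵒᵖ) (x := y.2))
    exact (nonneg_op_iff _).2 ⟨(s, t), by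
      change op (unop (inner Bᵐᵒᵖ y.1 y.1), unop (inner Dᵐᵒᵖ y.2 y.2)) = _
      rw [hs, ht]
      rfl⟩
  inner_self {y} := by
    rw [op_eq_zero_iff, Prod.ext_iff, Prod.ext_iff]
    simp [CStarModule.inner_self]
  inner_op_smul_right {c y y'} := by
    apply unop_injective
    change (unop (inner Bᵐᵒᵖ y.1 (op (unop c).1 • y'.1)),
      unop (inner Dᵐᵒᵖ y.2 (op (unop c).2 • y'.2))) = _
    rw [CStarModule.inner_op_smul_right, CStarModule.inner_op_smul_right]
    rfl
  inner_smul_right_complex := by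
    intros
    apply unop_injective
    simp
  star_inner y y' := by
    apply unop_injective
    change (star (unop (inner Bᵐᵒᵖ y.1 y'.1)), star (unop (inner Dᵐᵒᵖ y.2 y'.2))) = _
    rw [← unop_star, ← unop_star, CStarModule.star_inner, CStarModule.star_inner]
    rfl
  norm_eq_sqrt_norm_inner_self y := by
    rw [norm_op, Prod.norm_def, Prod.norm_def, norm_unop, norm_unop,
      Real.sqrt_monotone.map_max, ← CStarModule.norm_eq_sqrt_norm_inner_self,
      ← CStarModule.norm_eq_sqrt_norm_inner_self]

theorem sum_inner (y y' : X × Z) : inner (B × D)ᵐᵒᵖ y y' =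
    op (unop (inner Bᵐᵒᵖ y.1 y'.1), unop (inner Dᵐᵒᵖ y.2 y'.2)) := rfl

/-- The diagonal homomorphism `𝓛(X) ⊕ 𝓛(Z) → 𝓛(X ⊕ Z)`, `(S, T) (x, z) = (S x, T z)`. -/
def diag : (adjointable Bᵐᵒᵖ X × adjointable Dᵐᵒᵖ Z) →⋆ₙₐ[ℂ]
    adjointable (B × D)ᵐᵒᵖ (X × Z) where
  toFun P := ⟨P.1.1.prodMap P.2.1, (star P.1).1.prodMap (star P.2).1, fun y y' => by
    simp [sum_inner, inner_star]⟩
  map_smul' c P := rfl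
  map_zero' := rfl
  map_add' P Q := rfl
  map_mul' P Q := rfl
  map_star' P := (star_eq_of fun y y' => by
    simp [sum_inner, inner_star]).symm

end Sum

/-! ### The adding-tails correspondence

An `A`–`A`-correspondence is a right Hilbert `A`-module `X` (complete) with a ⋆-homomorphism
`φ : A → 𝓛(X)`. -/

section Tails

variable {A X : Type*} [NonUnitalCStarAlgebra A] [NormedAddCommGroup X] [NormedSpace ℂ X]
  [CompleteSpace X] [SMul Aᵐᵒᵖ X] [CStarModule Aᵐᵒᵖ X]
  (φ : A →⋆ₙₐ[ℂ] adjointable Aᵐᵒᵖ X)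

/-- The ideal `ker φ`. -/
def kerAlg : NonUnitalStarSubalgebra ℂ A where
  carrier := {a | φ a = 0}
  add_mem' {a b} (ha : φ a = 0) (hb : φ b = 0) := show φ (a + b) = 0 by simp [ha, hb]
  zero_mem' := map_zero φ
  mul_mem' {a b} (ha : φ a = 0) _ := show φ (a * b) = 0 by simp [ha]
  smul_mem' c a (ha : φ a = 0) := show φ (c • a) = 0 by simp [ha]
  star_mem' {a} (ha : φ a = 0) := show φ (star a) = 0 by simp [map_star, ha]

theorem mem_kerAlg {a : A} : a ∈ kerAlg φ ↔ φ a = 0 := Iff.rfl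

theorem mul_mem_kerAlg (a : A) {k : A} (hk : k ∈ kerAlg φ) : a * k ∈ kerAlg φ := by
  rw [mem_kerAlg] at hk ⊢
  simp [hk]

theorem norm_map_le (a : A) : ‖(φ a).1‖ ≤ ‖a‖ := NonUnitalStarAlgHom.norm_apply_le φ a

instance : IsClosed (kerAlg φ : Set A) := by
  have h : Continuous fun a => (φ a).1 :=
    AddMonoidHomClass.continuous_of_bound
      ((adjointable Aᵐᵒᵖ X).val.toLinearMap.toAddMonoidHom.comp (φ : A →+ adjointable Aᵐᵒᵖ X)) 1
      fun a => by rw [one_mul]; exact norm_map_le φ a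
  have h' : (kerAlg φ : Set A) = (fun a => (φ a).1) ⁻¹' {0} := by
    ext a
    exact (mem_kerAlg φ).trans Subtype.ext_iff
  rw [h']
  exact isClosed_singleton.preimage h

/-- The ideal `(ker φ)^⊥ = {b | b (ker φ) = 0}`. -/
def kerPerp : NonUnitalStarSubalgebra ℂ A where
  carrier := {b | ∀ k ∈ kerAlg φ, b * k = 0}
  add_mem' {a b} ha hb := fun k hk => by rw [add_mul, ha k hk, hb k hk, add_zero]
  zero_mem' := fun k _ => zero_mul k
  mul_mem' {a b} _ hb := fun k hk => by rw [mul_assoc, hb k hk, mul_zero]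
  smul_mem' c a ha := fun k hk => by rw [smul_mul_assoc, ha k hk, smul_zero]
  star_mem' {b} hb := fun k hk => by
    rw [← CStarRing.star_mul_self_eq_zero_iff, star_mul, star_star, mul_assoc,
      hb _ (mul_mem_kerAlg φ _ hk), mul_zero]

theorem mul_kerPerp {k b : A} (hk : k ∈ kerAlg φ) (hb : b ∈ kerPerp φ) : k * b = 0 := by
  rw [← star_eq_zero, star_mul]
  exact star_mem hb _ (star_mem hk)

/-- Katsura's ideal `J_X = φ⁻¹(𝓚(X)) ∩ (ker φ)^⊥`. -/
def katsuraIdeal : NonUnitalStarSubalgebra ℂ A :=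
  (compacts Aᵐᵒᵖ X).comap φ ⊓ kerPerp φ

/-- `K_φ^∞`, the `c₀`-direct sum of countably many copies of `ker φ`. The summands are indexed
from `0`, and the norm is the supremum norm. -/
abbrev TailAlg : Type _ := C₀(ℕ, kerAlg φ)

/-- The sequence `(a g₀, f₀ g₁, f₁ g₂, …)`. -/
def tailFun (b : A × TailAlg φ) (g : TailAlg φ) : ℕ → kerAlg φ
  | 0 => ⟨b.1 * (g 0 : A), mul_mem_kerAlg φ _ (g 0).2⟩
  | n + 1 => b.2 n * g (n + 1)

theorem norm_tailFun_le (b : A × TailAlg φ) (g : TailAlg φ) (n : ℕ) :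
    ‖tailFun φ b g n‖ ≤ ‖b‖ * ‖g n‖ := by
  cases n with
  | zero => exact (norm_mul_le b.1 (g 0 : A)).trans (by gcongr; exacts [norm_fst_le b, le_rfl])
  | succ n =>
    refine (norm_mul_le (b.2 n) (g (n + 1))).trans ?_
    gcongr
    exact (b.2.toBCF.norm_coe_le_norm n).trans (norm_snd_le b)

/-- Left multiplication by `(a, f₀, f₁, …)` on `K_φ^∞`. -/
def tailMul (b : A × TailAlg φ) (g : TailAlg φ) : TailAlg φ where
  toFun := tailFun φ b g
  continuous_toFun := continuous_of_discreteTopology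
  zero_at_infty' := by
    refine squeeze_zero_norm (norm_tailFun_le φ b g) ?_
    simpa using (zero_at_infty g).norm.const_mul ‖b‖

theorem tailMul_zero (b : A × TailAlg φ) (g : TailAlg φ) :
    (tailMul φ b g 0 : A) = b.1 * (g 0 : A) := rfl

theorem tailMul_succ (b : A × TailAlg φ) (g : TailAlg φ) (n : ℕ) :
    tailMul φ b g (n + 1) = b.2 n * g (n + 1) := rfl

/-- Two sequences are equal once their entries are. -/
theorem tail_ext {f g : TailAlg φ} (h0 : (f 0 : A) = g 0) (h : ∀ n, f (n + 1) = g (n + 1)) :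
    f = g := by
  ext n
  cases n with
  | zero => exact h0
  | succ n => rw [h n]

/-- `tailMul` as a bounded operator on `K_φ^∞`. -/
def tailOp (b : A × TailAlg φ) : TailAlg φ →L[ℂ] TailAlg φ :=
  LinearMap.mkContinuous
    { toFun := tailMul φ b
      map_add' := fun g h => tail_ext φ (by simp [tailMul_zero, mul_add])
        (fun n => by simp [tailMul_succ, mul_add])
      map_smul' := fun c g => tail_ext φ (mul_smul_comm c b.1 _)
        (fun n => mul_smul_comm c (b.2 n) _) }
    ‖b‖ fun g => by
      refine (BoundedContinuousFunction.norm_le (by positivity)).2 fun n => ?_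
      refine (norm_tailFun_le φ b g n).trans ?_
      gcongr
      exact g.toBCF.norm_coe_le_norm n

theorem tailOp_adj (b : A × TailAlg φ) (g h : TailAlg φ) :
    inner (TailAlg φ)ᵐᵒᵖ (tailOp φ b g) h = inner (TailAlg φ)ᵐᵒᵖ g (tailOp φ (star b) h) := by
  apply unop_injective
  change star (tailMul φ b g) * h = star g * tailMul φ (star b) h
  refine tail_ext φ ?_ fun n => ?_
  · simp [tailMul_zero, mul_assoc]
  · simp [tailMul_succ, mul_assoc]

/-- The left action of `A ⊕ K_φ^∞` on `T = K_φ^∞` (a right Hilbert module over itself):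
`(a, f) · g = (a g₀, f₀ g₁, f₁ g₂, …)`. -/
def tailAction : (A × TailAlg φ) →⋆ₙₐ[ℂ] adjointable (TailAlg φ)ᵐᵒᵖ (TailAlg φ) where
  toFun b := ⟨tailOp φ b, tailOp φ (star b), tailOp_adj φ b⟩
  map_smul' c b := Subtype.ext <| ContinuousLinearMap.ext fun _ =>
    tail_ext φ (smul_mul_assoc c b.1 _) fun n => smul_mul_assoc c (b.2 n) _
  map_zero' := Subtype.ext <| ContinuousLinearMap.ext fun _ =>
    tail_ext φ (zero_mul _) fun _ => zero_mul _
  map_add' _ _ := Subtype.ext <| ContinuousLinearMap.ext fun _ =>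
    tail_ext φ (add_mul _ _ _) fun _ => add_mul _ _ _
  map_mul' _ _ := Subtype.ext <| ContinuousLinearMap.ext fun _ =>
    tail_ext φ (mul_assoc _ _ _) fun _ => mul_assoc _ _ _
  map_star' b := (star_eq_of (tailOp_adj φ b)).symm

/-- The left action `φ^Y` of `A ⊕ K_φ^∞` on the right Hilbert `A ⊕ K_φ^∞`-module
`Y = X ⊕ T = X ⊕ K_φ^∞`:
`φ^Y(a, f)(x, g) = (φ(a) x, a g₀, f₀ g₁, f₁ g₂, …)`. -/
def tailsAction : (A × TailAlg φ) →⋆ₙₐ[ℂ]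
    adjointable (A × TailAlg φ)ᵐᵒᵖ (X × TailAlg φ) :=
  diag.comp ((φ.comp (NonUnitalStarAlgHom.fst ℂ A (TailAlg φ))).prod (tailAction φ))

theorem tailsAction_apply (a : A) (f : TailAlg φ) (x : X) (g : TailAlg φ) :
    (tailsAction φ (a, f)).1 (x, g) = ((φ a).1 x, tailMul φ (a, f) g) := rfl

/-- The canonical ⋆-homomorphism from the external direct sum `J_X ⊕ ker φ ⊕ K_φ^∞` to
`A ⊕ K_φ^∞`, `(j, k, f) ↦ (j + k, f)`. -/
def sumMap : (katsuraIdeal φ × kerAlg φ × TailAlg φ) →⋆ₙₐ[ℂ] A × TailAlg φ where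
  toFun t := ((t.1 : A) + t.2.1, t.2.2)
  map_smul' c t := by simp
  map_zero' := by simp
  map_add' s t := by
    ext1
    · simp only [Prod.fst_add, Prod.snd_add, NonUnitalStarSubalgebra.coe_add]
      abel
    · rfl
  map_mul' s t := by
    ext1
    · change (s.1 : A) * t.1 + s.2.1 * t.2.1 = (s.1 + s.2.1) * (t.1 + t.2.1)
      rw [add_mul, mul_add, mul_add, s.1.2.2 _ t.2.1.2, mul_kerPerp φ s.2.1.2 t.1.2.2, add_zero,
        zero_add]
    · rfl
  map_star' t := by
    ext1
    · simp
    · rfl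

end Tails

end AddingTails

end

/-! The operator `φ^Y(a, f)` is block diagonal, with blocks `φ(a)` on `X` and the tail action on
`T`. Since `X ⊕ T` is a module over the sum of two coefficient algebras, `𝓚(X ⊕ T) = 𝓚(X) ⊕ 𝓚(T)`
(`diag_mem_compacts_iff`), so compactness is tested on each block.

For a C⋆-algebra over itself the compacts are exactly the left multiplications (`compacts_self`).
The tail action multiplies by `(a, f₀, f₁, …)`. The entries `fₙ` already form a `c₀`-sequence in
`ker φ`, so the only obstruction is the first entry: some `k ∈ ker φ` must satisfy `a c = k c` for
all `c ∈ ker φ`, that is, `a - k ∈ (ker φ)^⊥` (`tailAction_mem_compacts_iff`). As `φ(a - k) = φ(a)`,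
the two conditions together say `a ∈ J_X + ker φ`, with `f` arbitrary. The sum is direct because
`ker φ ∩ (ker φ)^⊥ = 0`. -/

noncomputable section

namespace AddingTails

open MulOpposite

/-! ### Compact operators as a closed span. -/

section CompactSpan

variable {C : Type*} {X : Type*} [NonUnitalCStarAlgebra C] [PartialOrder C] [StarOrderedRing C]
  [NormedAddCommGroup X] [NormedSpace ℂ X] [SMul C X] [CStarModule C X]

theorem mem_compacts {T : adjointable C X} :
    T ∈ compacts C X ↔
      T ∈ closure (Submodule.span ℂ {T | ∃ ξ η : X, T = Theta C ξ η} : Set (adjointable C X)) :=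
  Iff.rfl

theorem Theta_mem_compacts (ξ η : X) : Theta C ξ η ∈ compacts C X :=
  subset_closure (Submodule.subset_span ⟨ξ, η, rfl⟩)

theorem isClosed_compacts : IsClosed (compacts C X : Set (adjointable C X)) := isClosed_closure

/-- A closed star subalgebra that contains every `Θ_{ξ, η}` contains `𝓚(X)`. -/
theorem compacts_le {S : NonUnitalStarSubalgebra ℂ (adjointable C X)}
    (hS : IsClosed (S : Set (adjointable C X))) (h : ∀ ξ η, Theta C ξ η ∈ S) :
    compacts C X ≤ S := by
  intro T hT
  refine closure_minimal (fun T hT => ?_) hS (mem_compacts.1 hT)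
  induction hT using Submodule.span_induction with
  | mem T h' =>
    obtain ⟨ξ, η, rfl⟩ := h'
    exact h ξ η
  | zero => exact zero_mem S
  | add T T' _ _ h h' => exact add_mem h h'
  | smul c T _ h => exact SMulMemClass.smul_mem c h

end CompactSpan

/-! ### Compact operators on a C⋆-algebra over itself. -/

section SelfModule

variable {K : Type*} [NonUnitalCStarAlgebra K]

/-- The left regular representation `K → 𝓛(K_K)`. -/
def leftMul : K →⋆ₙₐ[ℂ] adjointable Kᵐᵒᵖ K where
  toFun t := ⟨ContinuousLinearMap.mul ℂ K t, ContinuousLinearMap.mul ℂ K (star t), fun f g => by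
    apply unop_injective
    change star (t * f) * g = star f * (star t * g)
    rw [star_mul, mul_assoc]⟩
  map_smul' c t := Subtype.ext (map_smul (ContinuousLinearMap.mul ℂ K) c t)
  map_zero' := Subtype.ext (map_zero (ContinuousLinearMap.mul ℂ K))
  map_add' s t := Subtype.ext (map_add (ContinuousLinearMap.mul ℂ K) s t)
  map_mul' s t := Subtype.ext <| ContinuousLinearMap.ext fun g => mul_assoc s t g
  map_star' t := (star_eq_of fun f g => by
    apply unop_injective
    change star (t * f) * g = star f * (star t * g)
    rw [star_mul, mul_assoc]).symm

theorem leftMul_apply (t g : K) : (leftMul t).1 g = t * g := rfl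

theorem leftMul_injective : Function.Injective (leftMul (K := K)) := by
  refine (injective_iff_map_eq_zero _).2 fun t ht => ?_
  -- Evaluate the operator at `star t`.
  rw [← CStarRing.mul_star_self_eq_zero_iff, ← leftMul_apply, ht]
  rfl

theorem isometry_leftMul : Isometry (leftMul (K := K)) :=
  NonUnitalStarAlgHom.isometry leftMul leftMul_injective

theorem Theta_self (ξ η : K) : Theta Kᵐᵒᵖ ξ η = leftMul (ξ * star η) :=
  Subtype.ext <| ContinuousLinearMap.ext fun g => (mul_assoc ξ (star η) g).symm

/-- Without a unit, `t` need not be of the form `ξ η*`, but it is the limit of `t u` along an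
approximate unit, and `t u` acts as `Θ_{t, u*}`. -/
theorem leftMul_mem_compacts (t : K) : leftMul t ∈ compacts Kᵐᵒᵖ K := by
  let _ := CStarAlgebra.spectralOrder K
  have := CStarAlgebra.spectralOrderedRing K
  have h := (CStarAlgebra.increasingApproximateUnit K).tendsto_mul_left t
  have h' := (isometry_leftMul.continuous.tendsto t).comp h
  refine isClosed_compacts.mem_of_tendsto h' (.of_forall fun u => ?_)
  have := Theta_mem_compacts (C := Kᵐᵒᵖ) t (star u)
  rwa [Theta_self, star_star] at this

/-- `𝓚(K_K)` consists of the left multiplications by elements of `K`. -/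
theorem compacts_self : compacts Kᵐᵒᵖ K = NonUnitalStarAlgHom.range leftMul := by
  refine le_antisymm (compacts_le ?_ fun ξ η => ⟨ξ * star η, (Theta_self ξ η).symm⟩) ?_
  · rw [NonUnitalStarAlgHom.coe_range]
    exact isometry_leftMul.isClosedEmbedding.isClosed_range
  · rintro _ ⟨t, rfl⟩
    exact leftMul_mem_compacts t

end SelfModule

/-! ### Compact operators on an external direct sum. -/

section Sum

variable {B D : Type*} [NonUnitalCStarAlgebra B] [NonUnitalCStarAlgebra D]
  {X Z : Type*} [NormedAddCommGroup X] [NormedSpace ℂ X] [CompleteSpace X]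
  [SMul Bᵐᵒᵖ X] [CStarModule Bᵐᵒᵖ X]
  [NormedAddCommGroup Z] [NormedSpace ℂ Z] [CompleteSpace Z]
  [SMul Dᵐᵒᵖ Z] [CStarModule Dᵐᵒᵖ Z]

theorem diag_injective :
    Function.Injective (diag : (adjointable Bᵐᵒᵖ X × adjointable Dᵐᵒᵖ Z) →⋆ₙₐ[ℂ] _) := by
  intro P Q h
  have h' (y : X × Z) : (P.1.1 y.1, P.2.1 y.2) = (Q.1.1 y.1, Q.2.1 y.2) :=
    congrArg (fun T : adjointable (B × D)ᵐᵒᵖ (X × Z) => T.1 y) h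
  refine Prod.ext (Subtype.ext (ContinuousLinearMap.ext fun x => ?_))
    (Subtype.ext (ContinuousLinearMap.ext fun z => ?_))
  · exact congrArg Prod.fst (h' (x, 0))
  · exact congrArg Prod.snd (h' (0, z))

/-- Injective ⋆-homomorphisms of C⋆-algebras are isometric. This makes `diag` continuous and a
closed map, so closures can be moved through it in both directions. -/
theorem isometry_diag :
    Isometry (diag : (adjointable Bᵐᵒᵖ X × adjointable Dᵐᵒᵖ Z) →⋆ₙₐ[ℂ] _) :=
  NonUnitalStarAlgHom.isometry _ diag_injective

/-- No off-diagonal terms arise, because the inner product and the action are both coordinatewise.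
-/
theorem Theta_sum (ξ η : X × Z) : Theta (B × D)ᵐᵒᵖ ξ η =
    diag (Theta Bᵐᵒᵖ ξ.1 η.1, Theta Dᵐᵒᵖ ξ.2 η.2) := rfl

theorem Theta_zero_left {C V : Type*} [NonUnitalCStarAlgebra C] [PartialOrder C]
    [StarOrderedRing C] [NormedAddCommGroup V] [NormedSpace ℂ V] [SMul C V] [CStarModule C V]
    (η : V) : Theta C 0 η = 0 := by
  refine Subtype.ext <| ContinuousLinearMap.ext fun ζ => ext_inner (C := C) fun z => ?_
  change inner C z ((inner C η ζ : C) • (0 : V)) = inner C z 0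
  simp

/-- The `S` with this property form a closed ⋆-subalgebra, so generators suffice, and `Θ_{ξ, η} ⊕ 0
= Θ_{(ξ, 0), (η, 0)}`. -/
theorem diag_inl_mem_compacts {S : adjointable Bᵐᵒᵖ X} (hS : S ∈ compacts Bᵐᵒᵖ X) :
    diag (S, (0 : adjointable Dᵐᵒᵖ Z)) ∈ compacts (B × D)ᵐᵒᵖ (X × Z) := by
  have hc : Continuous fun S : adjointable Bᵐᵒᵖ X => diag (S, (0 : adjointable Dᵐᵒᵖ Z)) :=
    isometry_diag.continuous.comp (Continuous.prodMk_left 0)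
  have hcl := (isClosed_compacts (C := (B × D)ᵐᵒᵖ) (X := X × Z)).preimage hc
  let U := (compacts (B × D)ᵐᵒᵖ (X × Z)).comap ((diag (X := X) (Z := Z)).comp
    (NonUnitalStarAlgHom.inl ℂ (adjointable Bᵐᵒᵖ X) (adjointable Dᵐᵒᵖ Z)))
  refine compacts_le (S := U) hcl (fun ξ η => ?_) hS
  change diag (Theta Bᵐᵒᵖ ξ η, (0 : adjointable Dᵐᵒᵖ Z)) ∈ compacts (B × D)ᵐᵒᵖ (X × Z)
  rw [← Theta_zero_left (0 : Z)]
  exact Theta_mem_compacts (C := (B × D)ᵐᵒᵖ) (ξ, (0 : Z)) (η, 0)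

theorem diag_inr_mem_compacts {R : adjointable Dᵐᵒᵖ Z} (hR : R ∈ compacts Dᵐᵒᵖ Z) :
    diag ((0 : adjointable Bᵐᵒᵖ X), R) ∈ compacts (B × D)ᵐᵒᵖ (X × Z) := by
  have hc : Continuous fun R : adjointable Dᵐᵒᵖ Z => diag ((0 : adjointable Bᵐᵒᵖ X), R) :=
    isometry_diag.continuous.comp (Continuous.prodMk_right 0)
  have hcl := (isClosed_compacts (C := (B × D)ᵐᵒᵖ) (X := X × Z)).preimage hc
  let U := (compacts (B × D)ᵐᵒᵖ (X × Z)).comap ((diag (X := X) (Z := Z)).comp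
    (NonUnitalStarAlgHom.inr ℂ (adjointable Bᵐᵒᵖ X) (adjointable Dᵐᵒᵖ Z)))
  refine compacts_le (S := U) hcl (fun ξ η => ?_) hR
  change diag ((0 : adjointable Bᵐᵒᵖ X), Theta Dᵐᵒᵖ ξ η) ∈ compacts (B × D)ᵐᵒᵖ (X × Z)
  rw [← Theta_zero_left (0 : X)]
  exact Theta_mem_compacts (C := (B × D)ᵐᵒᵖ) ((0 : X), ξ) (0, η)

theorem compacts_sum_le : compacts (B × D)ᵐᵒᵖ (X × Z) ≤
    ((compacts Bᵐᵒᵖ X).prod (compacts Dᵐᵒᵖ Z)).map diag := by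
  refine compacts_le ?_ fun ξ η => ?_
  · rw [NonUnitalStarSubalgebra.coe_map]
    exact (isometry_diag (X := X) (Z := Z)).isClosedEmbedding.isClosedMap _
      (isClosed_compacts.prod isClosed_compacts)
  · exact ⟨_, ⟨Theta_mem_compacts _ _, Theta_mem_compacts _ _⟩, (Theta_sum ξ η).symm⟩

/-- `𝓚(X ⊕ Z) = 𝓚(X) ⊕ 𝓚(Z)` for an external direct sum. -/
theorem diag_mem_compacts_iff (P : adjointable Bᵐᵒᵖ X × adjointable Dᵐᵒᵖ Z) :
    diag P ∈ compacts (B × D)ᵐᵒᵖ (X × Z) ↔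
      P.1 ∈ compacts Bᵐᵒᵖ X ∧ P.2 ∈ compacts Dᵐᵒᵖ Z := by
  constructor
  · intro hP
    obtain ⟨Q, hQ, h⟩ := compacts_sum_le hP
    exact diag_injective h ▸ hQ
  · intro hP
    have h : P = (P.1, 0) + (0, P.2) := by simp
    rw [h, map_add]
    exact add_mem (diag_inl_mem_compacts hP.1) (diag_inr_mem_compacts hP.2)

end Sum

/-! ### The tail action and the preimage of the compacts. -/

section Tails

variable {A X : Type*} [NonUnitalCStarAlgebra A] [NormedAddCommGroup X] [NormedSpace ℂ X]
  [CompleteSpace X] [SMul Aᵐᵒᵖ X] [CStarModule Aᵐᵒᵖ X]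
  (φ : A →⋆ₙₐ[ℂ] adjointable Aᵐᵒᵖ X)

theorem eq_zero_of_mem_kerAlg_of_mem_kerPerp {d : A} (hk : d ∈ kerAlg φ) (hp : d ∈ kerPerp φ) :
    d = 0 := by
  rw [← CStarRing.mul_star_self_eq_zero_iff]
  exact hp _ (star_mem hk)

theorem sumMap_injective : Function.Injective (sumMap φ) := by
  refine (injective_iff_map_eq_zero _).2 fun ⟨j, k, f⟩ h => ?_
  have h1 : (j : A) + k = 0 := congrArg Prod.fst h
  have h2 : f = 0 := congrArg Prod.snd h
  -- `k = -j` lies in `ker φ` and in `(ker φ)^⊥`.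
  have hk : (k : A) = 0 := eq_zero_of_mem_kerAlg_of_mem_kerPerp φ k.2 <| by
    rw [← neg_eq_of_add_eq_zero_right h1]
    exact neg_mem j.2.2
  rw [hk, add_zero] at h1
  exact Prod.ext (Subtype.ext h1) (Prod.ext (Subtype.ext hk) h2)

/-- The sequence `(k, f₀, f₁, …)`. -/
def tailCons (k : kerAlg φ) (f : TailAlg φ) : TailAlg φ where
  toFun n := n.casesOn k f
  continuous_toFun := continuous_of_discreteTopology
  zero_at_infty' := by
    have h := zero_at_infty f
    -- Vanishing at infinity on `ℕ` is convergence to `0` along `atTop`, which ignores the shift by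
    -- one.
    rw [Filter.cocompact_eq_cofinite, Nat.cofinite_eq_atTop] at h ⊢
    exact (Filter.tendsto_add_atTop_iff_nat 1).1 h

theorem exists_tail_apply_zero (c : kerAlg φ) : ∃ g : TailAlg φ, g 0 = c :=
  ⟨tailCons φ c 0, rfl⟩

theorem tailAction_mem_compacts_iff (a : A) (f : TailAlg φ) :
    tailAction φ (a, f) ∈ compacts (TailAlg φ)ᵐᵒᵖ (TailAlg φ) ↔
      ∃ k ∈ kerAlg φ, a - k ∈ kerPerp φ := by
  rw [compacts_self]
  constructor
  · rintro ⟨t, ht⟩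
    -- If the action is multiplication by `t`, comparing zeroth entries on a `g` with `g 0 = c`
    -- gives `t 0 * c = a * c`.
    refine ⟨t 0, (t 0).2, fun c hc => ?_⟩
    obtain ⟨g, hg⟩ := exists_tail_apply_zero φ ⟨c, hc⟩
    have h : t * g = tailMul φ (a, f) g :=
      congrArg (fun T : adjointable (TailAlg φ)ᵐᵒᵖ (TailAlg φ) => T.1 g) ht
    have h0 := congrArg (fun s : TailAlg φ => (s 0 : A)) h
    simp only [tailMul_zero, ZeroAtInftyContinuousMap.mul_apply, hg,
      NonUnitalStarSubalgebra.coe_mul] at h0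
    rw [sub_mul, h0, sub_self]
  · rintro ⟨k, hk, hp⟩
    -- Replacing `a` by `k` changes nothing, since the zeroth entry of `g` lies in `ker φ`; the
    -- later entries agree by definition.
    refine ⟨tailCons φ ⟨k, hk⟩ f, Subtype.ext <| ContinuousLinearMap.ext fun g =>
      tail_ext φ ?_ fun n => rfl⟩
    have h := hp _ (g 0).2
    rw [sub_mul, sub_eq_zero] at h
    exact h.symm

theorem tailsAction_mem_compacts_iff (a : A) (f : TailAlg φ) :
    tailsAction φ (a, f) ∈ compacts (A × TailAlg φ)ᵐᵒᵖ (X × TailAlg φ) ↔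
      φ a ∈ compacts Aᵐᵒᵖ X ∧ ∃ k ∈ kerAlg φ, a - k ∈ kerPerp φ :=
  (diag_mem_compacts_iff _).trans (and_congr_right fun _ => tailAction_mem_compacts_iff φ a f)

theorem range_sumMap : NonUnitalStarAlgHom.range (sumMap φ) =
    (compacts (A × TailAlg φ)ᵐᵒᵖ (X × TailAlg φ)).comap (tailsAction φ) := by
  ext ⟨a, f⟩
  refine Iff.trans ?_ (tailsAction_mem_compacts_iff φ a f).symm
  constructor
  · rintro ⟨⟨j, k, f⟩, h⟩
    obtain ⟨rfl, rfl⟩ := Prod.ext_iff.1 h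
    change φ ((j : A) + k) ∈ _ ∧ ∃ k' ∈ kerAlg φ, (j : A) + k - k' ∈ kerPerp φ
    refine ⟨?_, k, k.2, by rw [add_sub_cancel_right]; exact j.2.2⟩
    rw [map_add, (mem_kerAlg φ).1 k.2, add_zero]
    exact j.2.1
  · rintro ⟨ha, k, hk, hp⟩
    have hj : a - k ∈ katsuraIdeal φ := by
      refine ⟨?_, hp⟩
      change φ (a - k) ∈ compacts Aᵐᵒᵖ X
      rwa [map_sub, (mem_kerAlg φ).1 hk, sub_zero]
    -- The preimage comes from the splitting `a = (a - k) + k`.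
    exact ⟨(⟨a - k, hj⟩, ⟨k, hk⟩, f), Prod.ext (sub_add_cancel a k) rfl⟩

end Tails

end AddingTails

end

theorem mainTheorem9 {A X : Type*} [NonUnitalCStarAlgebra A]
    [NormedAddCommGroup X] [NormedSpace ℂ X] [CompleteSpace X] [SMul Aᵐᵒᵖ X]
    [CStarModule Aᵐᵒᵖ X] (φ : A →⋆ₙₐ[ℂ] AddingTails.adjointable Aᵐᵒᵖ X) :
    Function.Injective (AddingTails.sumMap φ) ∧
      NonUnitalStarAlgHom.range (AddingTails.sumMap φ) =
        (AddingTails.compacts (A × AddingTails.TailAlg φ)ᵐᵒᵖ (X × AddingTails.TailAlg φ)).comap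
          (AddingTails.tailsAction φ) :=
  ⟨AddingTails.sumMap_injective φ, AddingTails.range_sumMap φ⟩
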